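/- Let $k$ be a field of characteristic zero, $S=k[x_0,x_1,x_2]$, and let $S_2=U(\mathfrak g_2)$ be the universal enveloping algebra of the free nilpotent Lie $k$-algebra $\mathfrak g_2$ of index $2$ on $x_0,x_1,x_2$. Put $y_{ij}=[x_i,x_j]$ for $i<j$; by the Poincaré–Birkhoff–Witt theorem $S_2=k[x_0,x_1,x_2,y_{01},y_{02},y_{12}]$ as a vector space (ordered monomials $\mathbf x^\beta\mathbf y^\alpha$), and on it we consider the operators $$\Delta_j=-\sum_{i<j}R([x_i,x_j])\,\partial_i,\qquad \nabla_j=\sum_{i>j}R([x_i,x_j])\,\partial_i\qquad(0\le j\le 2),$$ where $R$ is right multiplication and $\partial_i=\partial/\partial x_i$. Let $Y\subseteq\mathbb P^2_k$ be a closed subscheme with graded ideal $I_0\subseteq S$. A geometric quantization of $Y$ in $\mathbb P^2_{k,2}$ is given by graded ideals $I_{m,\alpha}\subseteq S$ ($m\ge 0$, $\alpha=(\alpha_{01},\alpha_{02},\alpha_{12})\in\mathbb Z_{\ge0}^3$, $|\alpha|=m$) with $I_{0,0}=I_0$ such that the subspaces $I_m=\bigoplus_{|\alpha|=m}I_{m,\alpha}\,\mathbf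 y^\alpha\subseteq S_2$ form a differential chain: for all $m$, all $j$ and all $i<l$ one has $y_{il}I_m\subseteq I_{m+1}$ and $\Delta_j(I_m)+\nabla_j(I_m)\subseteq I_{m+1}$. Its structure sheaf is $$\mathcal O_{2,Y}=\prod_{m\ge0}\ \bigoplus_{|\alpha|=m}\mathcal O_{Y_{m,\alpha}}(-2m),\qquad Y_{m,\alpha}=\operatorname{Proj}(S/I_{m,\alpha}).$$ The quantization is called infinite if infinitely many of the factors $\bigoplus_{|\alpha|=m}\mathcal O_{Y_{m,\alpha}}(-2m)$ are nonzero. Let $f\in S$ be a homogeneous polynomial and let $Y=Z(f)$ be the subscheme of $\mathbb P^2_k$ with graded ideal $(f)$. Then $Y$ admits an infinite geometric quantization in $\mathbb P^2_{k,2}$ if and only if $f$ is divisible by $x_i$ for some $i\in\{0,1,2\}$. -/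

import Mathlib

noncomputable section

namespace NCQuantization

attribute [local instance 100] LieRing.ofAssociativeRing

open MvPolynomial

universe u
variable (k : Type u) [Field k] (n : ℕ)

/-- The index set of the radical variables `y_{ij}`, `i < j`. -/
abbrev Pairs : Type := {p : Fin (n + 1) × Fin (n + 1) // p.1 < p.2}

/-- The free nilpotent Lie algebra of index two in `x_0, …, x_n`. -/
abbrev FreeNilLie : Type u :=
  FreeLieAlgebra k (Fin (n + 1)) ⧸
    LieModule.lowerCentralSeries k (FreeLieAlgebra k (Fin (n + 1)))
      (FreeLieAlgebra k (Fin (n + 1))) 2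

/-- The noncommutative graded algebra `S_2`. -/
abbrev S2 : Type u := UniversalEnvelopingAlgebra k (FreeNilLie k n)

/-- The quotient map from the free Lie algebra to the algebra `S_2`. -/
def toS2 : FreeLieAlgebra k (Fin (n + 1)) →ₗ[k] S2 k n :=
  (UniversalEnvelopingAlgebra.ι k : FreeNilLie k n →ₗ⁅k⁆ S2 k n).toLinearMap ∘ₗ
    (LieSubmodule.Quotient.mk' (LieModule.lowerCentralSeries k (FreeLieAlgebra k (Fin (n + 1)))
      (FreeLieAlgebra k (Fin (n + 1))) 2)).toLinearMap

/-- The generator `x_i` of `S_2`. -/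
def xGen (i : Fin (n + 1)) : S2 k n := toS2 k n (FreeLieAlgebra.of k i)

theorem toS2_lie (a b : FreeLieAlgebra k (Fin (n + 1))) :
    toS2 k n ⁅a, b⁆ = toS2 k n a * toS2 k n b - toS2 k n b * toS2 k n a := by
  have h : ∀ a, toS2 k n a = UniversalEnvelopingAlgebra.ι k
    (LieSubmodule.Quotient.mk a : FreeNilLie k n) := fun _ => rfl
  rw [h, LieSubmodule.Quotient.mk_bracket, LieHom.map_lie, LieRing.of_associative_ring_bracket]
  rfl

theorem toS2_eq_zero {a : FreeLieAlgebra k (Fin (n + 1))}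
    (ha : a ∈ LieModule.lowerCentralSeries k (FreeLieAlgebra k (Fin (n + 1)))
      (FreeLieAlgebra k (Fin (n + 1))) 2) : toS2 k n a = 0 := by
  have h : toS2 k n a = UniversalEnvelopingAlgebra.ι k
    (LieSubmodule.Quotient.mk a : FreeNilLie k n) := rfl
  rw [h, LieSubmodule.Quotient.mk_eq_zero'.2 ha, map_zero]

variable {k n} in
theorem freeLie_mem (p : LieSubalgebra k (FreeLieAlgebra k (Fin (n + 1))))
    (h : ∀ i, FreeLieAlgebra.of k i ∈ p) (a : FreeLieAlgebra k (Fin (n + 1))) : a ∈ p := by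
  have : p.incl.comp (FreeLieAlgebra.lift k (fun i => (⟨FreeLieAlgebra.of k i, h i⟩ : p))) =
      LieHom.id := by
    ext i
    simp
  have h2 := LieHom.congr_fun this a
  simp only [LieHom.comp_apply, LieHom.id_apply] at h2
  rw [← h2]
  exact Subtype.property _

variable {k n} in
/-- `S_2` is generated by `x_0, …, x_n` as an associative algebra. -/
theorem S2_mem (B : Subalgebra k (S2 k n)) (h : ∀ i, xGen k n i ∈ B) (u : S2 k n) : u ∈ B := by
  have hL : ∀ a, toS2 k n a ∈ B := by
    refine freeLie_mem
      { carrier := {a | toS2 k n a ∈ B}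
        add_mem' := ?_
        zero_mem' := ?_
        smul_mem' := ?_
        lie_mem' := ?_ } h
    · intro a b ha hb
      simpa using B.add_mem ha hb
    · simp
    · intro c a ha
      simpa using B.smul_mem ha c
    · intro a b ha hb
      change toS2 k n ⁅a, b⁆ ∈ B
      rw [toS2_lie]
      exact B.sub_mem (B.mul_mem ha hb) (B.mul_mem hb ha)
  let f : FreeNilLie k n →ₗ⁅k⁆ B :=
    { toFun := fun g => ⟨UniversalEnvelopingAlgebra.ι k g, by
        obtain ⟨a, rfl⟩ := LieSubmodule.Quotient.surjective_mk' _ g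
        exact hL a⟩
      map_add' := fun a b => by ext; simp
      map_smul' := fun a b => by ext; simp
      map_lie' := by
        intro a b
        ext
        simp [LieRing.of_associative_ring_bracket] }
  have : B.val.comp (UniversalEnvelopingAlgebra.lift k f) = AlgHom.id k _ := by
    apply UniversalEnvelopingAlgebra.hom_ext
    ext g
    simp [f]
  have h2 := DFunLike.congr_fun this u
  simp only [AlgHom.comp_apply, AlgHom.id_apply] at h2
  rw [← h2]
  exact Subtype.property _

/-- The radical variable `y_{ij} = [x_i, x_j]`. -/
def yGen (p : Pairs n) : S2 k n :=
  xGen k n p.1.1 * xGen k n p.1.2 - xGen k n p.1.2 * xGen k n p.1.1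

theorem comm_xGen_mem_center (i j : Fin (n + 1)) :
    xGen k n i * xGen k n j - xGen k n j * xGen k n i ∈ Subalgebra.center k (S2 k n) := by
  rw [Subalgebra.mem_center_iff]
  intro u
  have := S2_mem (Subalgebra.centralizer k
    {xGen k n i * xGen k n j - xGen k n j * xGen k n i}) (fun l => ?_) u
  · rw [Subalgebra.mem_centralizer_iff] at this
    exact (this _ rfl).symm
  · rw [Subalgebra.mem_centralizer_iff]
    rintro _ rfl
    have h := toS2_eq_zero (k := k) (n := n) (a := ⁅FreeLieAlgebra.of k l,
      ⁅FreeLieAlgebra.of k i, FreeLieAlgebra.of k j⁆⁆) (by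
        rw [LieModule.lowerCentralSeries_succ, LieModule.lowerCentralSeries_succ]
        exact LieSubmodule.lie_mem_lie (LieSubmodule.mem_top _)
          (LieSubmodule.lie_mem_lie (LieSubmodule.mem_top _) (by simp)))
    rw [toS2_lie, toS2_lie, sub_eq_zero] at h
    exact h.symm

/-- `y_{ij}` as an element of the center of `S_2`. -/
def yCentral (p : Pairs n) : Subalgebra.center k (S2 k n) :=
  ⟨yGen k n p, comm_xGen_mem_center k n _ _⟩

/-- The ordered monomial `x_0^{γ_0} ⋯ x_n^{γ_n} y^{γ_y}` in `S_2`; the `y_{ij}` commute, so that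
their order is immaterial. -/
def orderedMonomial (γ : Fin (n + 1) ⊕ Pairs n →₀ ℕ) : S2 k n :=
  ((List.finRange (n + 1)).map fun i => xGen k n i ^ γ (Sum.inl i)).prod *
    ((∏ p : Pairs n, yCentral k n p ^ γ (Sum.inr p) : Subalgebra.center k (S2 k n)) : S2 k n)

/-- The commutative polynomials in the Hall basis `z = x ⊔ y`. -/
abbrev PolyZ : Type u := MvPolynomial (Fin (n + 1) ⊕ Pairs n) k

/-- The ordered functional calculus `k[z] → S_2`. -/
def orderedCalculus : PolyZ k n →ₗ[k] S2 k n :=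
  (MvPolynomial.basisMonomials (Fin (n + 1) ⊕ Pairs n) k).constr k (orderedMonomial k n)

theorem orderedCalculus_monomial (γ : Fin (n + 1) ⊕ Pairs n →₀ ℕ) :
    orderedCalculus k n (monomial γ 1) = orderedMonomial k n γ := by
  have := (MvPolynomial.basisMonomials (Fin (n + 1) ⊕ Pairs n) k).constr_basis k
    (orderedMonomial k n) γ
  rwa [MvPolynomial.coe_basisMonomials] at this

/-- The derivation `-∑_{i < j} y_{ij} ∂_i` of `k[z]`. -/
def repDer (j : Fin (n + 1)) : Derivation k (PolyZ k n) (PolyZ k n) :=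
  ∑ i, if h : i < j then -((X (Sum.inr ⟨(i, j), h⟩) : PolyZ k n) • pderiv (Sum.inl i)) else 0

theorem repDer_apply (j : Fin (n + 1)) (f : PolyZ k n) : repDer k n j f =
    ∑ i, if h : i < j then -((X (Sum.inr ⟨(i, j), h⟩) : PolyZ k n) * pderiv (Sum.inl i) f)
      else 0 := by
  rw [repDer, ← Derivation.coeFnAddMonoidHom_apply, map_sum, Finset.sum_apply]
  refine Finset.sum_congr rfl fun i _ => ?_
  split_ifs <;> simp

theorem repDer_inr (j : Fin (n + 1)) (p : Pairs n) : repDer k n j (X (Sum.inr p)) = 0 := by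
  rw [repDer_apply]
  refine Finset.sum_eq_zero fun i _ => ?_
  simp [pderiv_X]

theorem repDer_inl (j i : Fin (n + 1)) : repDer k n j (X (Sum.inl i)) =
    if h : i < j then -(X (Sum.inr ⟨(i, j), h⟩) : PolyZ k n) else 0 := by
  rw [repDer_apply, Finset.sum_eq_single i]
  · simp
  · intro b _ hb
    simp [pderiv_X, hb.symm]
  · simp

theorem repDer_repDer_X (i j : Fin (n + 1)) (v : Fin (n + 1) ⊕ Pairs n) :
    repDer k n i (repDer k n j (X v)) = 0 := by
  rcases v with v | v
  · rw [repDer_inl]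
    split_ifs <;> simp [repDer_inr]
  · simp [repDer_inr]

theorem repDer_comm (i j : Fin (n + 1)) (f : PolyZ k n) :
    repDer k n i (repDer k n j f) = repDer k n j (repDer k n i f) := by
  have : ⁅repDer k n i, repDer k n j⁆ = 0 := by
    refine MvPolynomial.derivation_ext fun v => ?_
    simp [Derivation.commutator_apply, repDer_repDer_X]
  have h := DFunLike.congr_fun this f
  rwa [Derivation.commutator_apply, Derivation.zero_apply, sub_eq_zero] at h

/-- The operator `x_j - ∑_{i < j} y_{ij} ∂_i` on `k[z]`. -/
def repGen (j : Fin (n + 1)) : Module.End k (PolyZ k n) :=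
  LinearMap.mulLeft k (X (Sum.inl j)) + (repDer k n j).toLinearMap

theorem repGen_apply (j : Fin (n + 1)) (f : PolyZ k n) :
    repGen k n j f = X (Sum.inl j) * f + repDer k n j f := rfl

theorem repGen_comm (i j : Fin (n + 1)) : ⁅repGen k n i, repGen k n j⁆ =
    LinearMap.mulLeft k (repDer k n i (X (Sum.inl j)) - repDer k n j (X (Sum.inl i))) := by
  refine LinearMap.ext fun f => ?_
  simp only [LieRing.of_associative_ring_bracket, LinearMap.sub_apply, Module.End.mul_apply,
    repGen_apply, map_add, Derivation.leibniz, smul_eq_mul, LinearMap.mulLeft_apply,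
    repDer_comm k n i j]
  ring

theorem repGen_comm_comm (l i j : Fin (n + 1)) :
    ⁅repGen k n l, ⁅repGen k n i, repGen k n j⁆⁆ = 0 := by
  rw [repGen_comm]
  refine LinearMap.ext fun f => ?_
  simp only [LieRing.of_associative_ring_bracket, LinearMap.sub_apply, Module.End.mul_apply,
    repGen_apply, map_sub, Derivation.leibniz, smul_eq_mul, LinearMap.mulLeft_apply,
    repDer_repDer_X]
  simp only [LinearMap.zero_apply]
  ring

theorem smul_bracket (c : k) (a b : Module.End k (PolyZ k n)) : ⁅c • a, b⁆ = c • ⁅a, b⁆ := by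
  simp only [LieRing.of_associative_ring_bracket, smul_mul_assoc, mul_smul_comm, smul_sub]

theorem bracket_smul (c : k) (a b : Module.End k (PolyZ k n)) : ⁅a, c • b⁆ = c • ⁅a, b⁆ := by
  simp only [LieRing.of_associative_ring_bracket, smul_mul_assoc, mul_smul_comm, smul_sub]

/-- The Lie algebra representation of the free Lie algebra on `k[z]`. -/
def repFree : FreeLieAlgebra k (Fin (n + 1)) →ₗ⁅k⁆ Module.End k (PolyZ k n) :=
  FreeLieAlgebra.lift k (repGen k n)

theorem repFree_comm_comm (a b c : FreeLieAlgebra k (Fin (n + 1))) :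
    repFree k n ⁅a, ⁅b, c⁆⁆ = 0 := by
  have key : ∀ i j a, ⁅repFree k n a, ⁅repGen k n i, repGen k n j⁆⁆ = 0 := by
    intro i j
    refine freeLie_mem
      { carrier := {a | ⁅repFree k n a, ⁅repGen k n i, repGen k n j⁆⁆ = 0}
        add_mem' := ?_
        zero_mem' := ?_
        smul_mem' := ?_
        lie_mem' := ?_ } (fun l => ?_)
    · intro a b ha hb
      simp only [Set.mem_ofPred_eq] at ha hb ⊢
      rw [map_add, add_lie, ha, hb, add_zero]
    · simp
    · intro c a ha
      simp only [Set.mem_ofPred_eq] at ha ⊢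
      rw [map_smul, smul_bracket, ha, smul_zero]
    · intro a b ha hb
      change ⁅repFree k n a, _⁆ = 0 at ha
      change ⁅repFree k n b, _⁆ = 0 at hb
      change ⁅repFree k n ⁅a, b⁆, _⁆ = 0
      rw [LieHom.map_lie, lie_lie, ha, hb, lie_zero, lie_zero, sub_zero]
    · change ⁅repFree k n (FreeLieAlgebra.of k l), _⁆ = 0
      rw [repFree, FreeLieAlgebra.lift_of_apply]
      exact repGen_comm_comm k n l i j
  have key2 : ∀ i c a, ⁅repFree k n a, ⁅repGen k n i, repFree k n c⁆⁆ = 0 := by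
    intro i
    refine freeLie_mem
      { carrier := {c | ∀ a, ⁅repFree k n a, ⁅repGen k n i, repFree k n c⁆⁆ = 0}
        add_mem' := ?_
        zero_mem' := ?_
        smul_mem' := ?_
        lie_mem' := ?_ } (fun l => ?_)
    · intro c d hc hd a
      rw [map_add, lie_add, lie_add, hc, hd, add_zero]
    · intro a
      simp
    · intro t c hc a
      rw [map_smul, bracket_smul, bracket_smul, hc, smul_zero]
    · intro c d hc hd a
      have h1 := hc d
      have h2 := hd c
      rw [LieHom.map_lie, leibniz_lie (repGen k n i), h2, add_zero, ← lie_skew _ (repFree k n d), h1]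
      simp
    · intro a
      have := key i l a
      rwa [repFree, FreeLieAlgebra.lift_of_apply]
  have key3 : ∀ b c a, ⁅repFree k n a, ⁅repFree k n b, repFree k n c⁆⁆ = 0 := by
    refine freeLie_mem
      { carrier := {b | ∀ c a, ⁅repFree k n a, ⁅repFree k n b, repFree k n c⁆⁆ = 0}
        add_mem' := ?_
        zero_mem' := ?_
        smul_mem' := ?_
        lie_mem' := ?_ } (fun l => ?_)
    · intro c d hc hd b a
      rw [map_add, add_lie, lie_add, hc, hd, add_zero]
    · intro b a
      simp
    · intro t c hc b a
      rw [map_smul, smul_bracket, bracket_smul, hc, smul_zero]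
    · intro b d hb hd c a
      rw [LieHom.map_lie, lie_lie, hd, hb]
      simp
    · intro c a
      have := key2 l c a
      rwa [repFree, FreeLieAlgebra.lift_of_apply]
  rw [LieHom.map_lie, LieHom.map_lie]
  exact key3 b c a

theorem repFree_lcs (a : FreeLieAlgebra k (Fin (n + 1)))
    (ha : a ∈ LieModule.lowerCentralSeries k (FreeLieAlgebra k (Fin (n + 1)))
      (FreeLieAlgebra k (Fin (n + 1))) 2) : repFree k n a = 0 := by
  have h1 : LieModule.lowerCentralSeries k (FreeLieAlgebra k (Fin (n + 1)))
      (FreeLieAlgebra k (Fin (n + 1))) 1 ≤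
      { (⊤ : Submodule k (FreeLieAlgebra k (Fin (n + 1)))) with
        carrier := {b | ∀ a, repFree k n ⁅a, b⁆ = 0}
        add_mem' := fun {b c} hb hc a => by rw [lie_add, map_add, hb, hc, add_zero]
        zero_mem' := fun a => by simp
        smul_mem' := fun t b hb a => by rw [lie_smul, map_smul, hb, smul_zero]
        lie_mem := fun {c b} hb a => repFree_comm_comm k n a c b } := by
    rw [LieModule.lowerCentralSeries_succ, LieSubmodule.lieIdeal_oper_eq_span,
      LieSubmodule.lieSpan_le]
    rintro _ ⟨b, c, rfl⟩ a
    exact repFree_comm_comm k n a _ _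
  have h2 : LieModule.lowerCentralSeries k (FreeLieAlgebra k (Fin (n + 1)))
      (FreeLieAlgebra k (Fin (n + 1))) 2 ≤ (repFree k n).ker := by
    rw [LieModule.lowerCentralSeries_succ, LieSubmodule.lieIdeal_oper_eq_span,
      LieSubmodule.lieSpan_le]
    rintro _ ⟨b, c, rfl⟩
    exact LieHom.mem_ker.2 (h1 c.2 _)
  exact LieHom.mem_ker.1 (h2 ha)

/-- The representation of `S_2` on `k[z]` by `x_j ↦ x_j - ∑_{i < j} y_{ij} ∂_i`. -/
def rep : S2 k n →ₐ[k] Module.End k (PolyZ k n) :=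
  UniversalEnvelopingAlgebra.lift k
    { toFun := Submodule.liftQ _ (repFree k n).toLinearMap (fun a ha => repFree_lcs k n a ha)
      map_add' := fun a b => map_add _ a b
      map_smul' := fun a b => map_smul _ a b
      map_lie' := by
        intro a b
        obtain ⟨a, rfl⟩ := LieSubmodule.Quotient.surjective_mk' _ a
        obtain ⟨b, rfl⟩ := LieSubmodule.Quotient.surjective_mk' _ b
        exact LieHom.map_lie (repFree k n) a b }

theorem rep_xGen (i : Fin (n + 1)) : rep k n (xGen k n i) = repGen k n i := by
  have h : rep k n (xGen k n i) = repFree k n (FreeLieAlgebra.of k i) :=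
    UniversalEnvelopingAlgebra.lift_ι_apply k _ _
  rw [h, repFree, FreeLieAlgebra.lift_of_apply]

theorem rep_yGen (p : Pairs n) : rep k n (yGen k n p) = LinearMap.mulLeft k (X (Sum.inr p)) := by
  rw [yGen, map_sub, map_mul, map_mul, rep_xGen, rep_xGen, ← LieRing.of_associative_ring_bracket,
    repGen_comm, repDer_inl, repDer_inl, dif_neg (not_lt.2 p.2.le), dif_pos p.2]
  simp

theorem repGen_pow (j : Fin (n + 1)) (f : PolyZ k n) (hf : repDer k n j f = 0) (c : ℕ) :
    (repGen k n j ^ c) f = X (Sum.inl j) ^ c * f := by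
  induction c with
  | zero => simp
  | succ c ih =>
    rw [pow_succ', Module.End.mul_apply, ih, repGen_apply]
    simp only [Derivation.leibniz, hf, Derivation.leibniz_pow, repDer_inl]
    simp
    ring

theorem rep_list (l : List (Fin (n + 1))) (hl : l.Pairwise (· < ·)) (β : Fin (n + 1) → ℕ)
    (q : PolyZ k n) (hq : ∀ i, repDer k n i q = 0) :
    rep k n (l.map fun i => xGen k n i ^ β i).prod q =
      (l.map fun i => (X (Sum.inl i) : PolyZ k n) ^ β i).prod * q := by
  induction l with
  | nil => simp
  | cons h t ih =>
    rw [List.pairwise_cons] at hl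
    rw [List.map_cons, List.prod_cons, map_mul, Module.End.mul_apply, ih hl.2, map_pow, rep_xGen,
      repGen_pow, List.map_cons, List.prod_cons, mul_assoc]
    rw [Derivation.leibniz, hq, smul_zero, zero_add]
    have : ∀ t : List (Fin (n + 1)), (∀ i ∈ t, h < i) →
        repDer k n h (t.map fun i => (X (Sum.inl i) : PolyZ k n) ^ β i).prod = 0 := by
      intro t ht
      induction t with
      | nil => simp
      | cons a s ihs =>
        rw [List.map_cons, List.prod_cons, Derivation.leibniz,
          ihs (fun i hi => ht i (List.mem_cons_of_mem _ hi)), Derivation.leibniz_pow, repDer_inl,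
          dif_neg (not_lt.2 (ht a List.mem_cons_self).le)]
        simp
    rw [this t hl.1, smul_zero]

theorem rep_yMonomial (α : Pairs n → ℕ) (f : PolyZ k n) :
    rep k n ((∏ p : Pairs n, yCentral k n p ^ α p : Subalgebra.center k (S2 k n)) : S2 k n) f =
      (∏ p : Pairs n, X (Sum.inr p) ^ α p) * f := by
  have : (((rep k n).comp (Subalgebra.center k (S2 k n)).val)
      (∏ p : Pairs n, yCentral k n p ^ α p)) =
      LinearMap.mulLeft k (∏ p : Pairs n, (X (Sum.inr p) : PolyZ k n) ^ α p) := by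
    classical
    induction (Finset.univ : Finset (Pairs n)) using Finset.induction_on with
    | empty => exact LinearMap.ext fun f => by simp
    | insert a s ha ih =>
      rw [Finset.prod_insert ha, Finset.prod_insert ha, map_mul, ih, map_pow]
      have h : ((rep k n).comp (Subalgebra.center k (S2 k n)).val) (yCentral k n a) =
        LinearMap.mulLeft k (X (Sum.inr a)) := rep_yGen k n a
      rw [h, LinearMap.pow_mulLeft, LinearMap.mulLeft_mul]
      rfl
  exact LinearMap.congr_fun this f

theorem rep_orderedMonomial (γ : Fin (n + 1) ⊕ Pairs n →₀ ℕ) :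
    rep k n (orderedMonomial k n γ) 1 = monomial γ 1 := by
  rw [orderedMonomial, map_mul, Module.End.mul_apply, rep_yMonomial, mul_one, rep_list]
  · rw [MvPolynomial.monomial_eq, Finsupp.prod_fintype _ _ (by simp), Fintype.prod_sum_type,
      ← List.ofFn_eq_map, List.prod_ofFn]
    simp
  · exact List.sortedLT_finRange _ |>.pairwise
  · intro i
    have : ∀ s : Finset (Pairs n), repDer k n i
        (∏ p ∈ s, (X (Sum.inr p) : PolyZ k n) ^ γ (Sum.inr p)) = 0 := by
      classical
      intro s
      induction s using Finset.induction_on with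
      | empty => simp
      | insert a s ha ih =>
        rw [Finset.prod_insert ha, Derivation.leibniz, ih, Derivation.leibniz_pow, repDer_inr]
        simp
    exact this _

theorem orderedCalculus_injective : Function.Injective (orderedCalculus k n) := by
  have : (LinearMap.applyₗ (1 : PolyZ k n)) ∘ₗ (rep k n).toLinearMap ∘ₗ orderedCalculus k n =
      LinearMap.id := by
    refine (MvPolynomial.basisMonomials _ k).ext fun γ => ?_
    rw [MvPolynomial.coe_basisMonomials]
    simp [orderedCalculus_monomial, rep_orderedMonomial]
  intro a b hab
  have ha := LinearMap.congr_fun this a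
  have hb := LinearMap.congr_fun this b
  simp only [LinearMap.comp_apply, LinearMap.id_apply] at ha hb
  rw [← ha, ← hb, hab]

theorem mul_pow_of_central {A : Type*} [Ring A] (a h b : A) (hb : a * h - h * a = b)
    (hc : ∀ u, u * b = b * u) (c : ℕ) : a * h ^ c = h ^ c * a + c • (b * h ^ (c - 1)) := by
  induction c with
  | zero => simp
  | succ c ih =>
    have e : a * h = h * a + b := by rw [← hb]; abel
    have e2 : c • (b * h ^ (c - 1)) * h = c • (b * h ^ c) := by
      rcases c with _ | c
      · simp
      · rw [smul_mul_assoc, mul_assoc, ← pow_succ]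
        simp
    rw [pow_succ, ← mul_assoc, ih, add_mul, e2, mul_assoc, e, mul_add, hc (h ^ c),
      Nat.add_sub_cancel, add_smul, one_smul, mul_assoc]
    abel

/-- The span of the ordered monomials whose `x`-part is supported on a list. -/
def listSpan (l : List (Fin (n + 1))) : Submodule k (S2 k n) :=
  Submodule.span k {u | ∃ (β : Fin (n + 1) → ℕ) (α : Pairs n → ℕ),
    u = (l.map fun i => xGen k n i ^ β i).prod *
      ((∏ p : Pairs n, yCentral k n p ^ α p : Subalgebra.center k (S2 k n)) : S2 k n)}

theorem mul_yGen_mem_listSpan (l : List (Fin (n + 1))) (p : Pairs n) (u : S2 k n)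
    (hu : u ∈ listSpan k n l) : yGen k n p * u ∈ listSpan k n l := by
  classical
  induction hu using Submodule.span_induction with
  | mem u h =>
    obtain ⟨β, α, rfl⟩ := h
    refine Submodule.subset_span ⟨β, α + Pi.single p 1, ?_⟩
    have : (∏ q : Pairs n, yCentral k n q ^ (α + Pi.single p 1 : Pairs n → ℕ) q) =
        (∏ q : Pairs n, yCentral k n q ^ α q) * yCentral k n p := by
      simp only [Pi.add_apply, pow_add, Finset.prod_mul_distrib]
      congr 1
      rw [Finset.prod_eq_single p]
      · simp
      · intro b _ hb
        simp [hb]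
      · simp
    rw [this]
    have hc := Subalgebra.mem_center_iff.1 (yCentral k n p).2
    have : ((yCentral k n p : Subalgebra.center k (S2 k n)) : S2 k n) = yGen k n p := rfl
    rw [← this, ← hc, Subalgebra.coe_mul, mul_assoc]
  | zero => simp
  | add a b _ _ ha hb => rw [mul_add]; exact add_mem ha hb
  | smul c a _ ha => rw [mul_smul_comm]; exact Submodule.smul_mem _ _ ha

theorem mul_comm_mem_listSpan (l : List (Fin (n + 1))) (i j : Fin (n + 1)) (u : S2 k n)
    (hu : u ∈ listSpan k n l) :
    (xGen k n i * xGen k n j - xGen k n j * xGen k n i) * u ∈ listSpan k n l := by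
  rcases lt_trichotomy i j with h | rfl | h
  · exact mul_yGen_mem_listSpan k n l ⟨(i, j), h⟩ u hu
  · simp
  · have := mul_yGen_mem_listSpan k n l ⟨(j, i), h⟩ u hu
    rw [← neg_sub, neg_mul]
    exact neg_mem this

theorem pow_mul_mem_listSpan (h : Fin (n + 1)) (t : List (Fin (n + 1))) (ht : h ∉ t) (c : ℕ)
    (u : S2 k n) (hu : u ∈ listSpan k n t) : xGen k n h ^ c * u ∈ listSpan k n (h :: t) := by
  classical
  induction hu using Submodule.span_induction with
  | mem u hu =>
    obtain ⟨β, α, rfl⟩ := hu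
    refine Submodule.subset_span ⟨Function.update β h c, α, ?_⟩
    rw [List.map_cons, List.prod_cons, ← mul_assoc, Function.update_self]
    congr 3
    refine List.map_congr_left fun i hi => ?_
    rw [Function.update_of_ne]
    rintro rfl
    exact ht hi
  | zero => simp
  | add a b _ _ ha hb => rw [mul_add]; exact add_mem ha hb
  | smul c a _ ha => rw [mul_smul_comm]; exact Submodule.smul_mem _ _ ha

theorem xGen_mul_mem_listSpan (l : List (Fin (n + 1))) (hl : l.Nodup) (j : Fin (n + 1))
    (hj : j ∈ l) (u : S2 k n) (hu : u ∈ listSpan k n l) :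
    xGen k n j * u ∈ listSpan k n l := by
  classical
  induction l generalizing u with
  | nil => simp at hj
  | cons h t ih =>
    rw [List.nodup_cons] at hl
    induction hu using Submodule.span_induction with
    | mem u hu =>
      obtain ⟨β, α, rfl⟩ := hu
      have hmem : (t.map fun i => xGen k n i ^ β i).prod *
          ((∏ p : Pairs n, yCentral k n p ^ α p : Subalgebra.center k (S2 k n)) : S2 k n) ∈
          listSpan k n t := Submodule.subset_span ⟨β, α, rfl⟩
      rw [List.map_cons, List.prod_cons, mul_assoc, ← mul_assoc]
      by_cases hjh : j = h
      · subst hjh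
        rw [← pow_succ']
        exact pow_mul_mem_listSpan k n j t hl.1 _ _ hmem
      · rw [mul_pow_of_central _ _ _ rfl
          (Subalgebra.mem_center_iff.1 (comm_xGen_mem_center k n j h)), add_mul, mul_assoc,
          smul_mul_assoc, mul_assoc]
        refine add_mem (pow_mul_mem_listSpan k n h t hl.1 _ _
          (ih hl.2 ((List.mem_cons.1 hj).resolve_left hjh) _ hmem)) (nsmul_mem ?_ _)
        exact mul_comm_mem_listSpan k n _ _ _ _ (pow_mul_mem_listSpan k n h t hl.1 _ _ hmem)
    | zero => simp
    | add a b _ _ ha hb => rw [mul_add]; exact add_mem ha hb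
    | smul c a _ ha => rw [mul_smul_comm]; exact Submodule.smul_mem _ _ ha

theorem orderedCalculus_surjective : Function.Surjective (orderedCalculus k n) := by
  have hle : listSpan k n (List.finRange (n + 1)) ≤ LinearMap.range (orderedCalculus k n) := by
    rw [listSpan, Submodule.span_le]
    rintro _ ⟨β, α, rfl⟩
    refine ⟨monomial (Finsupp.equivFunOnFinite.symm (Sum.elim β α)) 1, ?_⟩
    rw [orderedCalculus_monomial, orderedMonomial]
    simp
  intro u
  refine hle ?_
  let B : Subalgebra k (S2 k n) :=
    { carrier := {u | ∀ w ∈ listSpan k n (List.finRange (n + 1)),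
        u * w ∈ listSpan k n (List.finRange (n + 1))}
      mul_mem' := fun {a b} ha hb w hw => by rw [mul_assoc]; exact ha _ (hb _ hw)
      add_mem' := fun {a b} ha hb w hw => by rw [add_mul]; exact add_mem (ha _ hw) (hb _ hw)
      algebraMap_mem' := fun c w hw => by
        rw [← Algebra.smul_def]; exact Submodule.smul_mem _ _ hw }
  have hu : u ∈ B := S2_mem B (fun j w hw =>
    xGen_mul_mem_listSpan k n _ (List.nodup_finRange _) j (List.mem_finRange j) w hw) u
  have := hu 1 (Submodule.subset_span ⟨0, 0, by simp⟩)
  rwa [mul_one] at this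

/-- The Poincaré–Birkhoff–Witt identification `k[z] = S_2` of vector spaces. -/
def pbw : PolyZ k n ≃ₗ[k] S2 k n :=
  LinearEquiv.ofBijective (orderedCalculus k n)
    ⟨orderedCalculus_injective k n, orderedCalculus_surjective k n⟩

/-! ### Differential operators on `S_2` -/

/-- The commutative multiplication operator by the Hall basis element `z_v` on `S_2 = k[z]`. -/
def commMul (v : Fin (n + 1) ⊕ Pairs n) : Module.End k (S2 k n) :=
  (pbw k n).conj (LinearMap.mulLeft k (X v))

/-- The operator `∂_i = ∂/∂x_i` on `S_2 = k[z]`. -/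
def partialX (i : Fin (n + 1)) : Module.End k (S2 k n) :=
  (pbw k n).conj (pderiv (Sum.inl i)).toLinearMap

/-- The operator `Δ_j = -∑_{i < j} R([x_i, x_j]) ∂_i` on `S_2`, where `R` is the right regular
representation. -/
def Delta (j : Fin (n + 1)) : Module.End k (S2 k n) :=
  -∑ i ∈ Finset.univ.filter (· < j),
    LinearMap.mulRight k (xGen k n i * xGen k n j - xGen k n j * xGen k n i) ∘ₗ partialX k n i

/-- The operator `∇_j = ∑_{i > j} R([x_i, x_j]) ∂_i` on `S_2`, where `R` is the right regular
representation. -/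
def Nabla (j : Fin (n + 1)) : Module.End k (S2 k n) :=
  ∑ i ∈ Finset.univ.filter (j < ·),
    LinearMap.mulRight k (xGen k n i * xGen k n j - xGen k n j * xGen k n i) ∘ₗ partialX k n i

/-! ### Geometric differential chains -/

/-- The commutative polynomial ring `S = k[x_0, …, x_n]`. -/
abbrev PolyX : Type u := MvPolynomial (Fin (n + 1)) k

/-- The standard grading of `S`. -/
abbrev grading : ℕ → Submodule k (PolyX k n) := MvPolynomial.homogeneousSubmodule (Fin (n + 1)) k

attribute [local instance] MvPolynomial.gradedAlgebra

variable {k n}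

/-- The element `a(x) y^α` of `S_2`. -/
def coeffMul (α : Pairs n →₀ ℕ) (a : PolyX k n) : S2 k n :=
  pbw k n (rename Sum.inl a * rename Sum.inr (monomial α (1 : k)))

/-- The subspace `⨁_{|α| = m} I_α y^α` of `S ⊗ R_2^{2m}⟨y⟩ ⊆ S_2` given by a family of ideals
`I_α` of `S`. -/
def component (I : (Pairs n →₀ ℕ) → Ideal (PolyX k n)) (m : ℕ) : Submodule k (S2 k n) :=
  Submodule.span k {u | ∃ (α : Pairs n →₀ ℕ) (a : PolyX k n),
    α.degree = m ∧ a ∈ I α ∧ u = coeffMul α a}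

variable (k n) in
/-- A differential chain `{I_m}` in `S_2` that consists of graded ideals
`I_m = ⨁_{|α| = m} I_{m,α} y^α` of the commutative algebras `S ⊗ R_2^{2m}⟨y⟩`. -/
structure GeometricChain where
  /-- the graded ideals `I_{m,α}`, where `m = |α|` -/
  ideal : (Pairs n →₀ ℕ) → Ideal (PolyX k n)
  homogeneous : ∀ α, (ideal α).IsHomogeneous (grading k n)
  chain : ∀ (m : ℕ) (p : Pairs n),
    (component ideal m).map (commMul k n (Sum.inr p)) ≤ component ideal (m + 1)
  delta : ∀ (m : ℕ) (j : Fin (n + 1)),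
    (component ideal m).map (Delta k n j) ≤ component ideal (m + 1)
  nabla : ∀ (m : ℕ) (j : Fin (n + 1)),
    (component ideal m).map (Nabla k n j) ≤ component ideal (m + 1)

/-! ### The structure sheaf of a geometric quantization -/

/-- The localization of `S / I` at a point `𝔭` of `ℙⁿ = Proj S`, by the image of `S \ 𝔭`; it is
zero if `I` is not contained in `𝔭`. -/
abbrev StalkRing (I : Ideal (PolyX k n)) (p : ProjectiveSpectrum (grading k n)) : Type u :=
  Localization (p.asHomogeneousIdeal.toIdeal.primeCompl.map
    (Ideal.Quotient.mk I : PolyX k n →+* PolyX k n ⧸ I))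

theorem exists_homogeneous_notMem (p : ProjectiveSpectrum (grading k n)) :
    ∃ e : ℕ, 0 < e ∧ ∃ f ∈ grading k n e, f ∉ p.asHomogeneousIdeal := by
  classical
  by_contra! h
  refine p.not_irrelevant_le fun x hx => ?_
  rw [HomogeneousIdeal.mem_irrelevant_iff, GradedRing.proj_apply] at hx
  rw [← DirectSum.sum_support_decompose (grading k n) x]
  refine sum_mem fun i _ => ?_
  rcases Nat.eq_zero_or_pos i with rfl | hi
  · rw [hx]
    exact zero_mem _
  · exact h i hi _ (SetLike.coe_mem _)

/-- The sections over `U ⊆ ℙⁿ` of the direct image of the twisted structure sheaf `𝒪_Z(-d)` of the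
closed subscheme `Z = Proj (S / I)`: the families of germs which are locally given by a fraction
`a / b` with homogeneous `a, b` such that `deg a - deg b = -d`. -/
def twistedSections (I : Ideal (PolyX k n)) (d : ℕ)
    (U : TopologicalSpace.Opens (ProjectiveSpectrum (grading k n))) :
    Submodule k (∀ p : U, StalkRing I p.1) where
  carrier := {s | ∀ p : U, ∃ V : TopologicalSpace.Opens (ProjectiveSpectrum (grading k n)),
    p.1 ∈ V ∧ ∃ (e : ℕ) (a b : PolyX k n), a ∈ grading k n e ∧ b ∈ grading k n (e + d) ∧
      ∀ q : U, q.1 ∈ V → b ∉ q.1.asHomogeneousIdeal ∧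
        s q * algebraMap (PolyX k n ⧸ I) (StalkRing I q.1) (Ideal.Quotient.mk I b) =
          algebraMap (PolyX k n ⧸ I) (StalkRing I q.1) (Ideal.Quotient.mk I a)}
  add_mem' := by
    intro s t hs ht p
    obtain ⟨V, hV, e, a, b, ha, hb, h⟩ := hs p
    obtain ⟨V', hV', e', a', b', ha', hb', h'⟩ := ht p
    refine ⟨V ⊓ V', ⟨hV, hV'⟩, e + (e' + d), a * b' + a' * b, b * b', ?_, ?_, ?_⟩
    · refine Submodule.add_mem _ (SetLike.mul_mem_graded ha hb') ?_
      have := SetLike.mul_mem_graded ha' hb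
      rwa [show e' + (e + d) = e + (e' + d) by ring] at this
    · have := SetLike.mul_mem_graded hb hb'
      rwa [show e + d + (e' + d) = e + (e' + d) + d by ring] at this
    · intro q hq
      obtain ⟨h1, h2⟩ := h q hq.1
      obtain ⟨h1', h2'⟩ := h' q hq.2
      refine ⟨fun hm => ?_, ?_⟩
      · exact (q.1.isPrime.mem_or_mem hm).elim h1 h1'
      · simp only [Pi.add_apply, map_add, map_mul, ← h2, ← h2']
        ring
  zero_mem' := by
    intro p
    obtain ⟨e, he, f, hf, hfp⟩ := exists_homogeneous_notMem p.1
    refine ⟨ProjectiveSpectrum.basicOpen _ f, hfp, d * e - d, 0, f ^ d, Submodule.zero_mem _,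
      ?_, ?_⟩
    · have := SetLike.pow_mem_graded d hf
      rwa [smul_eq_mul, ← Nat.sub_add_cancel (Nat.le_mul_of_pos_right d he)] at this
    · intro q hq
      refine ⟨fun h => hq (q.1.isPrime.mem_of_pow_mem _ h), by simp⟩
  smul_mem' := by
    intro c s hs p
    obtain ⟨V, hV, e, a, b, ha, hb, h⟩ := hs p
    refine ⟨V, hV, e, c • a, b, Submodule.smul_mem _ _ ha, hb, fun q hq => ⟨(h q hq).1, ?_⟩⟩
    rw [Pi.smul_apply, smul_mul_assoc, (h q hq).2, Algebra.smul_def, MvPolynomial.smul_eq_C_mul,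
      map_mul, map_mul, IsScalarTower.algebraMap_apply k (PolyX k n ⧸ I) (StalkRing I q.1)]
    rfl

namespace GeometricChain

/-- The sections of the factor `ρ_{m,*} 𝒪_{Y_m}(-2m) = ⨁_{|α| = m} 𝒪_{Y_{m,α}}(-2m)`, where
`Y_{m,α} = Proj (S / I_{m,α})`; there are only finitely many `α` with `|α| = m`. -/
abbrev factorSections (C : GeometricChain k n) (m : ℕ)
    (U : TopologicalSpace.Opens (ProjectiveSpectrum (grading k n))) : Type u :=
  ∀ α : {α : Pairs n →₀ ℕ // α.degree = m}, twistedSections (C.ideal α) (2 * m) U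

/-- The sections of the structure sheaf `𝒪_{2,Y} = ∏_m ρ_{m,*} 𝒪_{Y_m}(-2m)` of the geometric
quantization given by a chain of ideals. -/
abbrev structureSections (C : GeometricChain k n)
    (U : TopologicalSpace.Opens (ProjectiveSpectrum (grading k n))) : Type u :=
  ∀ m : ℕ, C.factorSections m U

/-- The structure sheaf is an infinite direct product: none of its tails `∏_{m ≥ N}` vanishes. -/
def IsInfinite (C : GeometricChain k n) : Prop :=
  ∀ N : ℕ, ∃ (U : TopologicalSpace.Opens (ProjectiveSpectrum (grading k n)))
    (s : C.structureSections U) (m : ℕ), N ≤ m ∧ s m ≠ 0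

end GeometricChain

/-- The closed subscheme of `ℙⁿ` with graded ideal `I₀` admits an infinite geometric quantization
in `ℙⁿ_{k,2}`. -/
def AdmitsInfiniteGeometricQuantization (I₀ : Ideal (PolyX k n)) : Prop :=
  ∃ C : GeometricChain k n, C.ideal 0 = I₀ ∧ C.IsInfinite

end NCQuantization

end

/-! In the coordinates $S_2=k[x,y]$ given by the Poincaré–Birkhoff–Witt theorem, right
multiplication by the central element $y_{ij}$ is ordinary multiplication. The operators in the
definition of a differential chain therefore send $a\,y^\alpha$ to signed sums of terms $(\partial_i
a)\,y^{\alpha+e_{ij}}$ with distinct $y$-exponents. Comparing coefficients of $y$-monomials, a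
geometric chain is the same as a family of graded ideals for which $I_{\alpha+e_{ij}}$ contains
$I_\alpha$, $\partial_iI_\alpha$ and $\partial_jI_\alpha$ (`ideal_le_add_single`, `pderiv_fst_mem`,
`pderiv_snd_mem`; conversely `ofIdeals`).

Suppose that no variable divides $f$, and put $d=\deg f$. For each pair $i<j$ let $l$ be the third
index. Some monomial of $f$ avoids $x_l$, and differentiating $f$ along it $d$ times uses only
$\partial_i$ and $\partial_j$. The result is a constant, nonzero in characteristic zero, so $I_{d
e_{ij}}=S$ (`ideal_eq_top`). If $|\alpha|>3d$, some coordinate of $\alpha$ is at least $d$, hence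
$I_\alpha=S$ by monotonicity, and all factors with $m>3d$ vanish.

If $x_l\mid f$, let $i<j$ be the other two indices. The ideal $(x_l)$ is stable under $\partial_i$
and $\partial_j$, so $I_\alpha=(x_l)$ may be kept along all positive powers of $y_{ij}$, with
$I_0=(f)$ and $I_\alpha=S$ elsewhere (`hyperplaneChain`). Every factor then has a section that does
not vanish at the generic point of the line $x_l=0$ (`hyperplaneChain_isInfinite`). -/

noncomputable section

namespace NCQuantization

attribute [local instance 100] LieRing.ofAssociativeRing

open MvPolynomial

attribute [local instance] MvPolynomial.gradedAlgebra

/-! ### The chain operators in Poincaré–Birkhoff–Witt coordinates. -/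

section Coordinates

variable {k : Type*} [Field k] {n : ℕ}

/-- Acting on $1$ undoes the ordering map, because an ordered monomial of $S_2$ sends $1$ to the
corresponding commutative monomial. This gives an explicit inverse of `pbw`. -/
theorem rep_pbw_one (q : PolyZ k n) : rep k n (pbw k n q) 1 = q := by
  have : (LinearMap.applyₗ (1 : PolyZ k n)) ∘ₗ (rep k n).toLinearMap ∘ₗ orderedCalculus k n =
      LinearMap.id := by
    refine (MvPolynomial.basisMonomials _ k).ext fun γ => ?_
    rw [MvPolynomial.coe_basisMonomials]
    simp [orderedCalculus_monomial, rep_orderedMonomial]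
  exact LinearMap.congr_fun this q

theorem pbw_symm_apply (u : S2 k n) : (pbw k n).symm u = rep k n u 1 := by
  rw [LinearEquiv.symm_apply_eq]
  obtain ⟨q, rfl⟩ := (pbw k n).surjective u
  rw [rep_pbw_one]

/-- Right multiplication by `y_{ij}` on `S_2` is the commutative multiplication on `k[z]`. -/
theorem pbw_mul_yGen (q : PolyZ k n) (p : Pairs n) :
    pbw k n q * yGen k n p = pbw k n (X (Sum.inr p) * q) := by
  rw [← LinearEquiv.symm_apply_eq, pbw_symm_apply,
    show pbw k n q * yGen k n p = yGen k n p * pbw k n q from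
      Subalgebra.mem_center_iff.1 (yCentral k n p).2 (pbw k n q), map_mul, Module.End.mul_apply, rep_pbw_one, rep_yGen]
  rfl

theorem X_mul_coeff (α : Pairs n →₀ ℕ) (a : PolyX k n) (p : Pairs n) :
    (X (Sum.inr p) : PolyZ k n) * (rename Sum.inl a * rename Sum.inr (monomial α (1 : k))) =
      rename Sum.inl a * rename Sum.inr (monomial (α + Finsupp.single p 1) (1 : k)) := by
  rw [monomial_add_single, map_mul, map_pow, rename_X]
  ring

theorem coeffMul_mul_yGen (α : Pairs n →₀ ℕ) (a : PolyX k n) (p : Pairs n) :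
    coeffMul α a * yGen k n p = coeffMul (α + Finsupp.single p 1) a := by
  rw [coeffMul, pbw_mul_yGen, X_mul_coeff, coeffMul]

theorem commMul_coeffMul (α : Pairs n →₀ ℕ) (a : PolyX k n) (p : Pairs n) :
    commMul k n (Sum.inr p) (coeffMul α a) = coeffMul (α + Finsupp.single p 1) a := by
  rw [commMul, LinearEquiv.conj_apply_apply, coeffMul, LinearEquiv.symm_apply_apply,
    LinearMap.mulLeft_apply, X_mul_coeff, coeffMul]

theorem partialX_coeffMul (α : Pairs n →₀ ℕ) (a : PolyX k n) (i : Fin (n + 1)) :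
    partialX k n i (coeffMul α a) = coeffMul α (pderiv i a) := by
  have h : pderiv (Sum.inl i : Fin (n + 1) ⊕ Pairs n) (rename Sum.inr (monomial α (1 : k))) = 0 := by
    classical
    refine pderiv_eq_zero_of_notMem_vars fun hi => ?_
    simpa using vars_rename _ _ hi
  rw [partialX, LinearEquiv.conj_apply_apply, coeffMul, LinearEquiv.symm_apply_apply, coeffMul,
    Derivation.coeFn_coe, Derivation.leibniz, h, smul_zero, zero_add,
    pderiv_rename Sum.inl_injective, smul_eq_mul, mul_comm]

theorem Delta_coeffMul (α : Pairs n →₀ ℕ) (a : PolyX k n) (j : Fin (n + 1)) :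
    Delta k n j (coeffMul α a) = -∑ i : Fin (n + 1), if h : i < j then
      coeffMul (α + Finsupp.single ⟨(i, j), h⟩ 1) (pderiv i a) else 0 := by
  rw [Delta, LinearMap.neg_apply, LinearMap.sum_apply, Finset.sum_filter]
  congr 1
  refine Finset.sum_congr rfl fun i _ => ?_
  split_ifs with h
  · rw [LinearMap.comp_apply, partialX_coeffMul, LinearMap.mulRight_apply]
    exact coeffMul_mul_yGen α _ ⟨(i, j), h⟩
  · rfl

/-- The sign comes from $[x_i,x_j]=-y_{ji}$ for $i>j$. -/
theorem Nabla_coeffMul (α : Pairs n →₀ ℕ) (a : PolyX k n) (j : Fin (n + 1)) :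
    Nabla k n j (coeffMul α a) = -∑ i : Fin (n + 1), if h : j < i then
      coeffMul (α + Finsupp.single ⟨(j, i), h⟩ 1) (pderiv i a) else 0 := by
  rw [Nabla, LinearMap.sum_apply, Finset.sum_filter, ← Finset.sum_neg_distrib]
  refine Finset.sum_congr rfl fun i _ => ?_
  split_ifs with h
  · rw [LinearMap.comp_apply, partialX_coeffMul, LinearMap.mulRight_apply, ← neg_sub, mul_neg]
    exact congrArg _ (coeffMul_mul_yGen α _ ⟨(j, i), h⟩)
  · simp

/-- The coefficient in `S` of `y^α` of an element of `S_2`. -/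
def yCoeff (α : Pairs n →₀ ℕ) : S2 k n →ₗ[k] PolyX k n :=
  (lcoeff (PolyX k n) α).restrictScalars k ∘ₗ
    (aeval (Sum.elim (fun i => C (X i)) X) :
      PolyZ k n →ₐ[k] MvPolynomial (Pairs n) (PolyX k n)).toLinearMap ∘ₗ
    (pbw k n).symm.toLinearMap

/-- Reading $k[x,y]$ as $S[y]$ turns $a\,y^\beta$ into a single monomial with coefficient $a$. -/
theorem yCoeff_coeffMul (α β : Pairs n →₀ ℕ) (a : PolyX k n) :
    yCoeff α (coeffMul β a) = if β = α then a else 0 := by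
  classical
  have h1 : aeval (fun i => (C (X i) : MvPolynomial (Pairs n) (PolyX k n))) a = C a := by
    have : aeval (fun i => (C (X i) : MvPolynomial (Pairs n) (PolyX k n))) =
        (IsScalarTower.toAlgHom k (PolyX k n) (MvPolynomial (Pairs n) (PolyX k n))) := by
      ext i : 1
      simp [MvPolynomial.algebraMap_eq]
    rw [this]
    rfl
  have h2 : aeval (X : Pairs n → MvPolynomial (Pairs n) (PolyX k n)) (monomial β (1 : k)) =
      monomial β 1 := by
    rw [aeval_monomial, map_one, one_mul, monomial_eq, C_1, one_mul]
  have h3 : (aeval (Sum.elim (fun i => C (X i)) X) :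
      PolyZ k n →ₐ[k] MvPolynomial (Pairs n) (PolyX k n))
      (rename Sum.inl a * rename Sum.inr (monomial β (1 : k))) = monomial β a := by
    rw [map_mul, aeval_rename, aeval_rename]
    simp only [Sum.elim_comp_inl, Sum.elim_comp_inr]
    rw [h1, h2, C_mul_monomial, mul_one]
  simp only [yCoeff, coeffMul, LinearMap.comp_apply, LinearEquiv.coe_coe,
    LinearEquiv.symm_apply_apply, AlgHom.toLinearMap_apply, h3, LinearMap.restrictScalars_apply]
  exact coeff_monomial _ _ _

/-- The sum over $\alpha$ is direct, so membership in a component can be tested one $y$-exponent at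
a time. This is how statements about subspaces of $S_2$ become statements about ideals of $S$. -/
theorem yCoeff_mem {I : (Pairs n →₀ ℕ) → Ideal (PolyX k n)} {m : ℕ} {u : S2 k n}
    (hu : u ∈ component I m) (α : Pairs n →₀ ℕ) : yCoeff α u ∈ I α := by
  have : component I m ≤ ((I α).restrictScalars k).comap (yCoeff α) := by
    rw [component, Submodule.span_le]
    rintro _ ⟨β, a, -, ha, rfl⟩
    change yCoeff α (coeffMul β a) ∈ I α
    rw [yCoeff_coeffMul]
    split_ifs with h
    · rwa [← h]
    · exact zero_mem _
  exact this hu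

theorem coeffMul_mem {I : (Pairs n →₀ ℕ) → Ideal (PolyX k n)} {α : Pairs n →₀ ℕ} {a : PolyX k n}
    (ha : a ∈ I α) {m : ℕ} (hm : α.degree = m) : coeffMul α a ∈ component I m :=
  Submodule.subset_span ⟨α, a, hm, ha, rfl⟩

end Coordinates

/-! ### Geometric chains as families of ideals closed under derivatives. -/

namespace GeometricChain

variable {k : Type*} [Field k] {n : ℕ}

theorem ideal_le_add_single (C : GeometricChain k n) (α : Pairs n →₀ ℕ) (p : Pairs n) :
    C.ideal α ≤ C.ideal (α + Finsupp.single p 1) := by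
  intro a ha
  have := yCoeff_mem (C.chain _ p ⟨_, coeffMul_mem ha rfl, rfl⟩) (α + Finsupp.single p 1)
  rwa [commMul_coeffMul, yCoeff_coeffMul, if_pos rfl] at this

/-- For $p=(i,j)$ the terms of $\Delta_j$ carry the distinct factors $y_{i'j}$ with $i'<j$, so the
coefficient at $\alpha+e_p$ isolates $\partial_i a$. -/
theorem pderiv_fst_mem (C : GeometricChain k n) {α : Pairs n →₀ ℕ} (p : Pairs n) {a : PolyX k n}
    (ha : a ∈ C.ideal α) : pderiv p.1.1 a ∈ C.ideal (α + Finsupp.single p 1) := by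
  have := yCoeff_mem (C.delta _ p.1.2 ⟨_, coeffMul_mem ha rfl, rfl⟩) (α + Finsupp.single p 1)
  rw [Delta_coeffMul, map_neg, neg_mem_iff, map_sum, Finset.sum_eq_single p.1.1] at this
  · rwa [dif_pos p.2, yCoeff_coeffMul, if_pos rfl] at this
  · intro i _ hi
    split_ifs with h
    · rw [yCoeff_coeffMul, if_neg]
      rw [add_right_inj, Finsupp.single_left_inj one_ne_zero]
      exact fun hp => hi (congrArg (fun q : Pairs n => q.1.1) hp)
    · exact map_zero _
  · simp

/-- The mirror image: for $p=(i,j)$ the operator $\nabla_i$ supplies the derivative in the larger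
index $j$. -/
theorem pderiv_snd_mem (C : GeometricChain k n) {α : Pairs n →₀ ℕ} (p : Pairs n) {a : PolyX k n}
    (ha : a ∈ C.ideal α) : pderiv p.1.2 a ∈ C.ideal (α + Finsupp.single p 1) := by
  have := yCoeff_mem (C.nabla _ p.1.1 ⟨_, coeffMul_mem ha rfl, rfl⟩) (α + Finsupp.single p 1)
  rw [Nabla_coeffMul, map_neg, neg_mem_iff, map_sum, Finset.sum_eq_single p.1.2] at this
  · rwa [dif_pos p.2, yCoeff_coeffMul, if_pos rfl] at this
  · intro i _ hi
    split_ifs with h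
    · rw [yCoeff_coeffMul, if_neg]
      rw [add_right_inj, Finsupp.single_left_inj one_ne_zero]
      exact fun hp => hi (congrArg (fun q : Pairs n => q.1.2) hp)
    · exact map_zero _
  · simp

/-- A family of graded ideals `I_α` such that `I_{α + e_{ij}}` contains `I_α`, `∂_i I_α` and
`∂_j I_α` gives a geometric differential chain. -/
def ofIdeals (I : (Pairs n →₀ ℕ) → Ideal (PolyX k n))
    (hI : ∀ α, (I α).IsHomogeneous (grading k n))
    (hle : ∀ α p, I α ≤ I (α + Finsupp.single p 1))
    (hfst : ∀ α p, ∀ a ∈ I α, pderiv p.1.1 a ∈ I (α + Finsupp.single p 1))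
    (hsnd : ∀ α p, ∀ a ∈ I α, pderiv p.1.2 a ∈ I (α + Finsupp.single p 1)) :
    GeometricChain k n where
  ideal := I
  homogeneous := hI
  chain m p := by
    rw [Submodule.map_le_iff_le_comap]
    refine Submodule.span_le.2 ?_
    rintro _ ⟨α, a, hα, ha, rfl⟩
    rw [SetLike.mem_coe, Submodule.mem_comap, commMul_coeffMul]
    exact coeffMul_mem (hle α p ha) (by simp [hα])
  delta m j := by
    rw [Submodule.map_le_iff_le_comap]
    refine Submodule.span_le.2 ?_
    rintro _ ⟨α, a, hα, ha, rfl⟩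
    rw [SetLike.mem_coe, Submodule.mem_comap, Delta_coeffMul]
    refine neg_mem (sum_mem fun i _ => ?_)
    split_ifs with h
    · exact coeffMul_mem (hfst α ⟨(i, j), h⟩ a ha) (by simp [hα])
    · exact zero_mem _
  nabla m j := by
    rw [Submodule.map_le_iff_le_comap]
    refine Submodule.span_le.2 ?_
    rintro _ ⟨α, a, hα, ha, rfl⟩
    rw [SetLike.mem_coe, Submodule.mem_comap, Nabla_coeffMul]
    refine neg_mem (sum_mem fun i _ => ?_)
    split_ifs with h
    · exact coeffMul_mem (hsnd α ⟨(j, i), h⟩ a ha) (by simp [hα])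
    · exact zero_mem _

theorem ideal_mono (C : GeometricChain k n) {α β : Pairs n →₀ ℕ} (h : α ≤ β) :
    C.ideal α ≤ C.ideal β := by
  obtain ⟨γ, rfl⟩ := exists_add_of_le h
  clear h
  induction γ using Finsupp.induction_linear generalizing α with
  | zero => rw [add_zero]
  | add β γ hβ hγ => rw [← add_assoc]; exact hβ.trans hγ
  | single p m =>
    induction m with
    | zero => rw [Finsupp.single_zero, add_zero]
    | succ m ih =>
      rw [Finsupp.single_add, ← add_assoc]
      exact ih.trans (C.ideal_le_add_single _ p)

/-- If a homogeneous `g ∈ I_α` contains a monomial in the two variables `x_i`, `x_j`, then its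
derivatives along this monomial show that `I_{α + (deg g) e_{ij}}` is the unit ideal. -/
theorem ideal_eq_top [CharZero k] (C : GeometricChain k n) (p : Pairs n) (N : ℕ)
    {α : Pairs n →₀ ℕ} {g : PolyX k n} (hg : g ∈ C.ideal α) (hN : g.IsHomogeneous N)
    {β : Fin (n + 1) →₀ ℕ} (hβ : coeff β g ≠ 0) (hp : ∀ i, i ≠ p.1.1 → i ≠ p.1.2 → β i = 0) :
    C.ideal (α + Finsupp.single p N) = ⊤ := by
  classical
  induction N generalizing α g β with
  | zero =>
    rw [Finsupp.single_zero, add_zero]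
    -- In degree zero $g$ is a constant, and its nonzero coefficient makes it a unit in the ideal.
    rw [totalDegree_eq_zero_iff_eq_C.1 ((totalDegree_zero_iff_isHomogeneous _).2 hN)] at hg hβ
    rw [coeff_C] at hβ
    split_ifs at hβ with h0
    · exact Ideal.eq_top_of_isUnit_mem _ hg ((Ne.isUnit hβ).map _)
    · exact absurd rfl hβ
  | succ N ih =>
    obtain ⟨i, hi⟩ : ∃ i, β i ≠ 0 := by
      by_contra! h
      have h2 := hN hβ
      have : β = 0 := Finsupp.ext h
      simp [this] at h2
    have hmem : pderiv i g ∈ C.ideal (α + Finsupp.single p 1) := by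
      by_cases h1 : i = p.1.1
      · exact h1 ▸ C.pderiv_fst_mem p hg
      · by_cases h2 : i = p.1.2
        · exact h2 ▸ C.pderiv_snd_mem p hg
        · exact absurd (hp i h1 h2) hi
    have hle : Finsupp.single i 1 ≤ β := by
      rw [Finsupp.single_le_iff]
      omega
    -- The coefficient of $\partial_i g$ at $\beta-e_i$ is $\beta_i$ times that of $g$ at $\beta$;
    -- characteristic zero keeps it nonzero.
    have := ih hmem hN.pderiv (β := β - Finsupp.single i 1) (by
      rw [coeff_pderiv, tsub_add_cancel_of_le hle]
      exact mul_ne_zero hβ (Nat.cast_add_one_ne_zero _)) (fun l h1 h2 => by simp [hp l h1 h2])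
    rwa [add_assoc, ← Finsupp.single_add, add_comm 1 N] at this

end GeometricChain

/-! ### Vanishing and nonvanishing of twisted sections. -/

section Sections

variable {k : Type*} [Field k] {n : ℕ}

theorem twistedSections_subsingleton {I : Ideal (PolyX k n)} (hI : I = ⊤) (d : ℕ)
    (U : TopologicalSpace.Opens (ProjectiveSpectrum (grading k n))) :
    Subsingleton (twistedSections I d U) := by
  have (p : U) : Subsingleton (StalkRing I p.1) := by
    have : Subsingleton (PolyX k n ⧸ I) := Ideal.Quotient.subsingleton_iff.2 hI
    exact Unique.instSubsingleton
  infer_instance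

/-- If $1=0$ in the localization, the class of some $c\notin\mathfrak p$ annihilates $1$ in $S/I$,
that is $c\in I\subseteq\mathfrak p$. -/
theorem stalkRing_nontrivial {I : Ideal (PolyX k n)} {p : ProjectiveSpectrum (grading k n)}
    (h : I ≤ p.asHomogeneousIdeal.toIdeal) : Nontrivial (StalkRing I p) := by
  refine ⟨1, 0, fun h10 => ?_⟩
  rw [← map_one (algebraMap (PolyX k n ⧸ I) (StalkRing I p)),
    IsLocalization.map_eq_zero_iff (p.asHomogeneousIdeal.toIdeal.primeCompl.map
      (Ideal.Quotient.mk I : PolyX k n →+* PolyX k n ⧸ I))] at h10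
  obtain ⟨⟨_, c, hc, rfl⟩, h0⟩ := h10
  rw [mul_one] at h0
  exact hc (h (Ideal.Quotient.eq_zero_iff_mem.1 h0))

/-- If `b` is homogeneous of degree `d`, then the section `1 / b` of `𝒪_Z(-d)` over `D(b)` does
not vanish at a point of `Z`. -/
theorem exists_twistedSections_ne_zero {I : Ideal (PolyX k n)}
    {p : ProjectiveSpectrum (grading k n)} (h : I ≤ p.asHomogeneousIdeal.toIdeal) {d : ℕ}
    {b : PolyX k n} (hb : b ∈ grading k n d) (hbp : b ∉ p.asHomogeneousIdeal) :
    ∃ s : twistedSections I d (ProjectiveSpectrum.basicOpen (grading k n) b), s ≠ 0 := by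
  have := stalkRing_nontrivial h
  let s : ∀ q : ProjectiveSpectrum.basicOpen (grading k n) b, StalkRing I q.1 := fun q =>
    IsLocalization.mk' _ (1 : PolyX k n ⧸ I)
      (⟨Ideal.Quotient.mk I b, Submonoid.mem_map_of_mem _ q.2⟩ :
        q.1.asHomogeneousIdeal.toIdeal.primeCompl.map
          (Ideal.Quotient.mk I : PolyX k n →+* PolyX k n ⧸ I))
  have hs (q) : s q * algebraMap (PolyX k n ⧸ I) (StalkRing I q.1) (Ideal.Quotient.mk I b) =
      algebraMap (PolyX k n ⧸ I) (StalkRing I q.1) 1 := IsLocalization.mk'_spec _ _ _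
  -- A single fraction serves on all of $D(b)$: numerator $1$ of degree $0$, denominator $b$ of
  -- degree $0+d$.
  refine ⟨⟨s, fun q => ⟨_, q.2, 0, 1, b, SetLike.one_mem_graded _, ?_, fun q' _ => ⟨q'.2, ?_⟩⟩⟩,
    fun h0 => ?_⟩
  · rwa [zero_add]
  · rw [hs, map_one (Ideal.Quotient.mk I)]
  · have h1 := hs ⟨p, hbp⟩
    have h2 : s ⟨p, hbp⟩ = 0 := congrFun (congrArg Subtype.val h0) ⟨p, hbp⟩
    rw [h2, zero_mul, map_one] at h1
    exact zero_ne_one h1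

/-- The generic point of the hyperplane `x_l = 0`, provided that there is another variable. -/
def hyperplanePoint {l i : Fin (n + 1)} (hi : i ≠ l) : ProjectiveSpectrum (grading k n) where
  asHomogeneousIdeal := ⟨Ideal.span {X l}, Ideal.homogeneous_span _ _ (by
    rintro _ rfl
    exact ⟨1, isHomogeneous_X k l⟩)⟩
  isPrime := (Ideal.span_singleton_prime (X_ne_zero l)).2 X_prime
  not_irrelevant_le h := by
    have : (X i : PolyX k n) ∈ HomogeneousIdeal.irrelevant (grading k n) := by
      rw [HomogeneousIdeal.mem_irrelevant_iff, GradedRing.proj_apply,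
        DirectSum.decompose_of_mem_ne (grading k n) (isHomogeneous_X k i) one_ne_zero]
    exact hi (X_dvd_X.1 (Ideal.mem_span_singleton.1 (h this))).symm

theorem X_notMem_hyperplanePoint {l i : Fin (n + 1)} (hi : i ≠ l) :
    (X i : PolyX k n) ∉ (hyperplanePoint hi : ProjectiveSpectrum (grading k n)).asHomogeneousIdeal :=
  fun h => hi (X_dvd_X.1 (Ideal.mem_span_singleton.1 h)).symm

end Sections

/-! ### Divisibility by a variable, on monomials and under derivatives. -/

theorem exists_coeff_ne_zero_of_not_X_dvd {σ R : Type*} [CommRing R] {i : σ} {f : MvPolynomial σ R}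
    (h : ¬X i ∣ f) : ∃ β : σ →₀ ℕ, β i = 0 ∧ coeff β f ≠ 0 := by
  rw [X_dvd_iff_modMonomial_eq_zero] at h
  obtain ⟨β, hβ⟩ := ne_zero_iff.1 h
  by_cases hle : Finsupp.single i 1 ≤ β
  · exact absurd (coeff_modMonomial_of_le f hle) hβ
  · rw [coeff_modMonomial_of_not_le f hle] at hβ
    rw [Finsupp.single_le_iff] at hle
    exact ⟨β, by omega, hβ⟩

theorem pderiv_mem_span_X {σ R : Type*} [CommRing R] {i l : σ} (h : i ≠ l) {a : MvPolynomial σ R}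
    (ha : a ∈ Ideal.span {X l}) : pderiv i a ∈ Ideal.span {(X l : MvPolynomial σ R)} := by
  obtain ⟨c, rfl⟩ := Ideal.mem_span_singleton.1 ha
  rw [pderiv_mul, pderiv_X_of_ne h.symm, zero_mul, zero_add]
  exact Ideal.mul_mem_right _ _ (Ideal.mem_span_singleton_self _)

/-! ### The infinite chain attached to a variable dividing $f$. -/

section Hyperplane

variable {k : Type*} [Field k] {n : ℕ}

open Classical in
/-- The ideals `I_0 = (f)`, `I_α = (x_l)` if `α ≠ 0` involves only `y_p`, and `I_α = S`
otherwise. -/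
def hyperplaneIdeal (f : PolyX k n) (l : Fin (n + 1)) (p : Pairs n) (α : Pairs n →₀ ℕ) :
    Ideal (PolyX k n) :=
  if α = 0 then Ideal.span {f} else if ∀ q, q ≠ p → α q = 0 then Ideal.span {X l} else ⊤

/-- Covers all three closure conditions, with $b$ either $a$ or one of its derivatives. Only the
direction $q=p$ needs an argument: any other step leaves the powers of $y_p$ and lands in the unit
ideal, so $\partial_l$, which does not preserve $(x_l)$, causes no harm. -/
theorem mem_hyperplaneIdeal_add_single {f : PolyX k n} {l : Fin (n + 1)} {p : Pairs n}
    (hf : X l ∣ f) {α : Pairs n →₀ ℕ} (q : Pairs n) {a b : PolyX k n}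
    (ha : a ∈ hyperplaneIdeal f l p α)
    (hb : q = p → a ∈ Ideal.span {X l} → b ∈ Ideal.span {X l}) :
    b ∈ hyperplaneIdeal f l p (α + Finsupp.single q 1) := by
  rw [hyperplaneIdeal, if_neg (fun h => by simpa using DFunLike.congr_fun h q)]
  split_ifs with h
  · refine hb ?_ ?_
    · by_contra hq
      simpa using h q hq
    · have hα : ∀ r, r ≠ p → α r = 0 := fun r hr => by
        have := h r hr
        -- A vanishing coordinate of the sum forces that of $\alpha$ to vanish, so the source ideal
        -- is $(f)$ or $(x_l)$, both inside $(x_l)$.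
        rw [Finsupp.add_apply] at this
        omega
      rw [hyperplaneIdeal, if_pos hα] at ha
      split_ifs at ha
      · exact Ideal.span_singleton_le_span_singleton.2 hf ha
      · exact ha
  · trivial

theorem hyperplaneIdeal_isHomogeneous {f : PolyX k n} {d : ℕ} (hf : f.IsHomogeneous d)
    (l : Fin (n + 1)) (p : Pairs n) (α : Pairs n →₀ ℕ) :
    (hyperplaneIdeal f l p α).IsHomogeneous (grading k n) := by
  rw [hyperplaneIdeal]
  split_ifs
  · exact Ideal.homogeneous_span _ _ (by rintro _ rfl; exact ⟨d, hf⟩)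
  · exact Ideal.homogeneous_span _ _ (by rintro _ rfl; exact ⟨1, isHomogeneous_X k l⟩)
  · exact (⊤ : HomogeneousIdeal (grading k n)).isHomogeneous

/-- The chain of ideals `(f) ⊆ (x_l) ⊆ (x_l) ⊆ ⋯` along the powers of `y_p`. -/
def hyperplaneChain {f : PolyX k n} {d : ℕ} (hf : f.IsHomogeneous d) {l : Fin (n + 1)}
    (hl : X l ∣ f) {p : Pairs n} (h1 : p.1.1 ≠ l) (h2 : p.1.2 ≠ l) : GeometricChain k n :=
  GeometricChain.ofIdeals (hyperplaneIdeal f l p) (hyperplaneIdeal_isHomogeneous hf l p)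
    (fun _ q _ ha => mem_hyperplaneIdeal_add_single hl q ha fun _ => id)
    (fun _ q _ ha => mem_hyperplaneIdeal_add_single hl q ha fun hq => by
      subst hq; exact pderiv_mem_span_X h1)
    (fun _ q _ ha => mem_hyperplaneIdeal_add_single hl q ha fun hq => by
      subst hq; exact pderiv_mem_span_X h2)

theorem hyperplaneChain_ideal_zero {f : PolyX k n} {d : ℕ} (hf : f.IsHomogeneous d)
    {l : Fin (n + 1)} (hl : X l ∣ f) {p : Pairs n} (h1 : p.1.1 ≠ l) (h2 : p.1.2 ≠ l) :
    (hyperplaneChain hf hl h1 h2).ideal 0 = Ideal.span {f} := by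
  change hyperplaneIdeal f l p 0 = _
  rw [hyperplaneIdeal, if_pos rfl]

theorem hyperplaneIdeal_single_le {f : PolyX k n} {l : Fin (n + 1)} (hl : X l ∣ f) (p : Pairs n)
    (m : ℕ) : hyperplaneIdeal f l p (Finsupp.single p m) ≤ Ideal.span {X l} := by
  rw [hyperplaneIdeal, if_pos (fun q hq => Finsupp.single_eq_of_ne hq)]
  split_ifs
  · exact Ideal.span_singleton_le_span_singleton.2 hl
  · exact le_rfl

theorem hyperplaneChain_isInfinite {f : PolyX k n} {d : ℕ} (hf : f.IsHomogeneous d)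
    {l : Fin (n + 1)} (hl : X l ∣ f) {p : Pairs n} (h1 : p.1.1 ≠ l) (h2 : p.1.2 ≠ l) :
    (hyperplaneChain hf hl h1 h2).IsInfinite := by
  classical
  intro N
  have hle : (hyperplaneChain hf hl h1 h2).ideal (Finsupp.single p N) ≤
      (hyperplanePoint h1 : ProjectiveSpectrum (grading k n)).asHomogeneousIdeal.toIdeal :=
    hyperplaneIdeal_single_le hl p N
  -- The denominator $x_i^{2N}$, where $i$ is the first index of $p$, has the degree required by the
  -- twist $-2N$ and is nonzero at the generic point of $x_l=0$.
  obtain ⟨s, hs⟩ := exists_twistedSections_ne_zero hle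
    (b := X p.1.1 ^ (2 * N)) (d := 2 * N) (isHomogeneous_X_pow _ _)
    (fun h => X_notMem_hyperplanePoint h1 ((hyperplanePoint h1).isPrime.mem_of_pow_mem _ h))
  let α : {α : Pairs n →₀ ℕ // α.degree = N} := ⟨Finsupp.single p N, by simp⟩
  -- The section is extended by zero to the other exponents $\alpha$ and the other factors.
  refine ⟨_, Pi.single N (Pi.single α s), N, le_rfl, fun h => hs ?_⟩
  have := congrFun h α
  rwa [Pi.single_eq_same, Pi.single_eq_same] at this

end Hyperplane

/-! ### Three variables: pairs of indices against the remaining index. -/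

theorem exists_coordinate_of_pair (p : Pairs 2) :
    ∃ l : Fin 3, ∀ i, i ≠ p.1.1 → i ≠ p.1.2 → i = l := by
  revert p
  decide

theorem exists_pair_of_coordinate (l : Fin 3) : ∃ p : Pairs 2, p.1.1 ≠ l ∧ p.1.2 ≠ l := by
  revert l
  decide

theorem exists_X_dvd_of_isInfinite {k : Type*} [Field k] [CharZero k] {d : ℕ} {f : PolyX k 2}
    (hf : f.IsHomogeneous d) (C : GeometricChain k 2) (hC : C.ideal 0 = Ideal.span {f})
    (hinf : C.IsInfinite) : ∃ i : Fin 3, X i ∣ f := by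
  by_contra! hdvd
  have htop (p : Pairs 2) : C.ideal (Finsupp.single p d) = ⊤ := by
    obtain ⟨l, hl⟩ := exists_coordinate_of_pair p
    obtain ⟨β, hβ, hβf⟩ := exists_coeff_ne_zero_of_not_X_dvd (hdvd l)
    have := C.ideal_eq_top p d (hC ▸ Ideal.mem_span_singleton_self f) hf hβf
      (fun i h1 h2 => hl i h1 h2 ▸ hβ)
    rwa [zero_add] at this
  -- If every coordinate of $\alpha$ is below $d$, then $|\alpha|$ is at most $d$ times the number
  -- of pairs. One more than this bound forces some coordinate to reach $d$.
  obtain ⟨U, s, m, hm, hs⟩ := hinf (Fintype.card (Pairs 2) * d + 1)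
  refine hs (funext fun α => ?_)
  obtain ⟨p, hp⟩ : ∃ p, d ≤ α.1 p := by
    by_contra! h
    have h1 : α.1.degree ≤ Fintype.card (Pairs 2) * d := by
      rw [Finsupp.degree_eq_sum]
      exact Finset.sum_le_card_nsmul _ _ _ fun p _ => (h p).le
    have h2 := α.2
    omega
  have hα : C.ideal α = ⊤ :=
    top_le_iff.1 (htop p ▸ C.ideal_mono (Finsupp.single_le_iff.2 hp))
  have := twistedSections_subsingleton hα (2 * m) U
  exact Subsingleton.elim _ _

end NCQuantization

end

theorem mainTheorem8 {k : Type*} [Field k] [CharZero k] (d : ℕ)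
    (f : MvPolynomial (Fin 3) k) (hf : f.IsHomogeneous d) :
    NCQuantization.AdmitsInfiniteGeometricQuantization (n := 2) (Ideal.span {f}) ↔
      ∃ i : Fin 3, MvPolynomial.X i ∣ f := by
  constructor
  · rintro ⟨C, hC, hinf⟩
    exact NCQuantization.exists_X_dvd_of_isInfinite hf C hC hinf
  · rintro ⟨l, hl⟩
    obtain ⟨p, h1, h2⟩ := NCQuantization.exists_pair_of_coordinate l
    exact ⟨NCQuantization.hyperplaneChain hf hl h1 h2,
      NCQuantization.hyperplaneChain_ideal_zero hf hl h1 h2,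
      NCQuantization.hyperplaneChain_isInfinite hf hl h1 h2⟩
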